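/- **Theorem (Burge summation formula).** For integers $N,M\ge 0$, a *partition in $(N,M)$* is a sequence of integers $M\ge p_N\ge p_{N-1}\ge\cdots\ge p_1\ge 0$; its weight is $\mathrm{wt}(p)=p_1+\cdots+p_N$. If $N<0$ or $M<0$ there are no partitions in $(N,M)$. Use the conventions $p_i=0$ for $i\le 0$ and $p_i=M$ for $i>N$. For integers $N_1,M_1,N_2,M_2,a,b,\alpha,\beta$, let $\mathcal R(N_1,M_1,N_2,M_2,a,b,\alpha,\beta)$ be the set of pairs $(r,p)$, with $r$ a partition in $(N_1,M_1)$ and $p$ a partition in $(N_2,M_2)$, such that $$p_i-r_{i+1-a}\ge 1-\alpha\quad\text{for }\max\{1,a\}\le i\le\min\{N_2,N_1+a-1\},$$ $$r_i-p_{i+1-b}\ge 1-\beta\quad\text{for }\max\{1,b\}\le i\le\min\{N_1,N_2+b-1\},$$ and, moreover: if $a=0$ then $r_1\le\alpha-1$; if $b=0$ then $p_1\le\beta-1$; if $a=N_2-N_1$ then $p_{N_2}\ge M_1-\alpha+1$; if $b=N_1-N_2$ then $r_{N_1}\ge M_2-\beta+1$. Let $$R(N_1,M_1,N_2,M_2,a,b,\alpha,\beta)=\sum_{(r,p)\in\mathcal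 R(N_1,M_1,N_2,M_2,a,b,\alpha,\beta)}q^{\mathrm{wt}(r)+\mathrm{wt}(p)}$$ (so $R=0$ if one of $N_1,M_1,N_2,M_2$ is negative). Let $(q)_n=\prod_{j=1}^n(1-q^j)$, and let $\left[{P\atop N}\right]=\dfrac{(q)_P}{(q)_N(q)_{P-N}}$ if $P\ge N\ge 0$, and $\left[{P\atop N}\right]=0$ otherwise. Let $N_1,M_1,N_2,M_2,a,b$ be non-negative integers and $\alpha,\beta$ integers with $a+b>0$, $\alpha-a\ge 0$, $\beta-b\ge 0$ and $(\alpha-a)+(\beta-b)>0$. Put $\Delta N=N_1-N_2$ and $\Delta M=M_1-M_2$, and suppose that $-a\le\Delta N\le b$, $-\beta\le\Delta M\le\alpha$, $b-\beta\le\Delta M+\Delta N\le\alpha-a$, and $M_1+\Delta N\ge 0$, $M_2-\Delta N\ge 0$. Then, as an identity in the indeterminate $q$, $$R(N_1,M_1,N_2,M_2,a,b,\alpha,\beta)=\sum_{i=0}^{N_2}q^{i^2+i\Delta N}\left[{M_1+M_2+N_2-i\atop N_2-i}\right]R(i+\Delta N,\,M_1-i,\,i,\,M_2-\Delta N-i,\,a,\,b,\,\alpha-a,\,\beta-b).$$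 -/

import Mathlib

/-- The partitions in `(N, M)`, that is, the sequences `0 ≤ p_1 ≤ p_2 ≤ ⋯ ≤ p_N ≤ M` of `N` integers;
`p j` is the part `p_{j+1}`. There are none if `N < 0` or `M < 0`, and exactly one
(the empty sequence) if `N = 0 ≤ M`. -/
noncomputable def boxPartitions (N M : ℤ) : Finset (Fin N.toNat → ℤ) :=
  if 0 ≤ N ∧ 0 ≤ M then
    (Fintype.piFinset fun _ => Finset.Icc 0 M).filter fun p => ∀ j k, j ≤ k → p j ≤ p k
  else ∅

/-- The part `p_i` of a partition in `(N, M)`, where `1 ≤ i ≤ N`, extended by the usual convention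
`p_i = 0` for `i ≤ 0` and `p_i = M` for `i > N`. -/
noncomputable def boxPart (N M : ℤ) (p : Fin N.toNat → ℤ) (i : ℤ) : ℤ :=
  if i ≤ 0 then 0
  else if h : (i - 1).toNat < N.toNat then p ⟨(i - 1).toNat, h⟩
  else M

/-- The partition pair `(q, p)` in `(N₁, M₁) × (N₂, M₂)` is restricted. -/
noncomputable def IsRestricted (N₁ M₁ N₂ M₂ a b α β : ℤ)
    (q : Fin N₁.toNat → ℤ) (p : Fin N₂.toNat → ℤ) : Prop :=
  (∀ i ∈ Finset.Icc (max 1 a) (min N₂ (N₁ + a - 1)),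
      1 - α ≤ boxPart N₂ M₂ p i - boxPart N₁ M₁ q (i + 1 - a)) ∧
  (∀ i ∈ Finset.Icc (max 1 b) (min N₁ (N₂ + b - 1)),
      1 - β ≤ boxPart N₁ M₁ q i - boxPart N₂ M₂ p (i + 1 - b)) ∧
  (a = 0 → boxPart N₁ M₁ q 1 ≤ α - 1) ∧
  (b = 0 → boxPart N₂ M₂ p 1 ≤ β - 1) ∧
  (a = N₂ - N₁ → M₁ - α + 1 ≤ boxPart N₂ M₂ p N₂) ∧
  (b = N₁ - N₂ → M₂ - β + 1 ≤ boxPart N₁ M₁ q N₁)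

noncomputable instance (N₁ M₁ N₂ M₂ a b α β : ℤ) (q : Fin N₁.toNat → ℤ) (p : Fin N₂.toNat → ℤ) :
    Decidable (IsRestricted N₁ M₁ N₂ M₂ a b α β q p) := by
  unfold IsRestricted
  infer_instance

/-- The set of restricted partition pairs `(q, p)` in `(N₁, M₁) × (N₂, M₂)`. -/
noncomputable def restrictedPairs (N₁ M₁ N₂ M₂ a b α β : ℤ) :
    Finset ((Fin N₁.toNat → ℤ) × (Fin N₂.toNat → ℤ)) :=
  (boxPartitions N₁ M₁ ×ˢ boxPartitions N₂ M₂).filter fun x =>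
    IsRestricted N₁ M₁ N₂ M₂ a b α β x.1 x.2

/-- The generating function `R(N₁, M₁, N₂, M₂, a, b, α, β)` of the restricted partition pairs by
weight, where the indeterminate `q` is `RatFunc.X`. -/
noncomputable def burgeR (N₁ M₁ N₂ M₂ a b α β : ℤ) : RatFunc ℚ :=
  ∑ x ∈ restrictedPairs N₁ M₁ N₂ M₂ a b α β,
    (RatFunc.X : RatFunc ℚ) ^ ((∑ j, x.1 j) + ∑ j, x.2 j)

/-- The `q`-shifted factorial `(q)_n = (1 - q)(1 - q²)⋯(1 - qⁿ)`. -/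
noncomputable def qFactorial (n : ℕ) : RatFunc ℚ :=
  ∏ j ∈ Finset.Icc 1 n, (1 - (RatFunc.X : RatFunc ℚ) ^ j)

/-- The Gaussian polynomial, equal to `(q)_P / ((q)_N (q)_{P-N})` if `P ≥ N ≥ 0` and to `0`
otherwise. -/
noncomputable def gaussianPoly (P N : ℤ) : RatFunc ℚ :=
  if 0 ≤ N ∧ N ≤ P then
    qFactorial P.toNat / (qFactorial N.toNat * qFactorial (P - N).toNat)
  else 0

/-! Both sides obey the same recurrences, so the identity follows by induction on N₁ + M₁ + N₂ + M₂.
On the left, split by whether the largest part of r equals M₁: this removes one part or lowers the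
height by one (`burgeR_step`), and `burgeR_step'` is its mirror image for p. On the right, applying
these recurrences to the inner R's, together with the q-Pascal rule, turns the defect of the
recurrence into a telescoping sum (`burgeSum_step`).

The bounds on the parameters leave at least one recurrence available except at extreme points.
There, either the box dimensions force both sides to vanish (`burgeR_of_collision`,
`burgeSum_of_collision`), or only one summand survives and every R is a product of Gaussian
polynomials (`burgeR_eq_burgeSum_of_eq`). Exchanging the two partitions halves the work. -/

/-! ### Gaussian polynomials and the q-Pascal rule. -/

theorem one_sub_X_pow_ne_zero (n : ℕ) : (1 : RatFunc ℚ) - RatFunc.X ^ (n + 1) ≠ 0 := by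
  intro h
  have h' : algebraMap (Polynomial ℚ) (RatFunc ℚ) (1 - Polynomial.X ^ (n + 1)) = 0 := by
    rw [map_sub, map_pow, map_one, RatFunc.algebraMap_X, h]
  have h2 := (map_eq_zero_iff _ (RatFunc.algebraMap_injective ℚ)).1 h'
  have h3 := congrArg (Polynomial.eval 0) h2
  simp at h3

theorem qFactorial_succ (n : ℕ) :
    qFactorial (n + 1) = qFactorial n * (1 - (RatFunc.X : RatFunc ℚ) ^ (n + 1)) := by
  rw [qFactorial, Finset.prod_Icc_succ_top (by omega), qFactorial]

theorem qFactorial_zero : qFactorial 0 = 1 := by simp [qFactorial]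

theorem qFactorial_ne_zero (n : ℕ) : qFactorial n ≠ 0 := by
  induction n with
  | zero => rw [qFactorial_zero]; exact one_ne_zero
  | succ n ih => rw [qFactorial_succ]; exact mul_ne_zero ih (one_sub_X_pow_ne_zero n)

/-- The Gaussian polynomial of an `N × M` box. -/
noncomputable def gaussianBox (N M : ℤ) : RatFunc ℚ := gaussianPoly (N + M) N

theorem gaussianBox_of_neg {N M : ℤ} (h : N < 0 ∨ M < 0) : gaussianBox N M = 0 := by
  rw [gaussianBox, gaussianPoly, if_neg (by omega)]

theorem gaussianBox_natCast (n m : ℕ) :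
    gaussianBox n m = qFactorial (n + m) / (qFactorial n * qFactorial m) := by
  rw [gaussianBox, gaussianPoly, if_pos (by omega)]
  have h1 : ((n : ℤ) + m).toNat = n + m := by omega
  have h2 : ((n : ℤ) + m - n).toNat = m := by omega
  rw [h1, h2, Int.toNat_natCast]

theorem gaussianBox_zero_left {M : ℤ} (h : 0 ≤ M) : gaussianBox 0 M = 1 := by
  lift M to ℕ using h
  have := gaussianBox_natCast 0 M
  rw [Nat.cast_zero] at this
  rw [this, qFactorial_zero, zero_add, one_mul, div_self (qFactorial_ne_zero M)]

theorem gaussianBox_zero_right {N : ℤ} (h : 0 ≤ N) : gaussianBox N 0 = 1 := by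
  lift N to ℕ using h
  have := gaussianBox_natCast N 0
  rw [Nat.cast_zero] at this
  rw [this, qFactorial_zero, add_zero, mul_one, div_self (qFactorial_ne_zero N)]

/-- The `q`-Pascal recurrence. -/
theorem gaussianBox_step {N M : ℤ} (hN : 0 ≤ N) (hM : 0 ≤ M) (h : 0 < N + M) :
    gaussianBox N M =
      (RatFunc.X : RatFunc ℚ) ^ M * gaussianBox (N - 1) M + gaussianBox N (M - 1) := by
  rcases hN.eq_or_lt with rfl | hN
  · rw [gaussianBox_of_neg (N := 0 - 1) (by omega), gaussianBox_zero_left hM,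
      gaussianBox_zero_left (by omega)]
    ring
  rcases hM.eq_or_lt with rfl | hM
  · rw [gaussianBox_of_neg (M := 0 - 1) (by omega), gaussianBox_zero_right hN.le,
      gaussianBox_zero_right (by omega)]
    simp
  obtain ⟨n, rfl⟩ : ∃ n : ℕ, N = (n + 1 : ℕ) := ⟨(N - 1).toNat, by omega⟩
  obtain ⟨m, rfl⟩ : ∃ m : ℕ, M = (m + 1 : ℕ) := ⟨(M - 1).toNat, by omega⟩
  have e1 : ((n + 1 : ℕ) : ℤ) - 1 = n := by omega
  have e2 : ((m + 1 : ℕ) : ℤ) - 1 = m := by omega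
  rw [e1, e2, gaussianBox_natCast, gaussianBox_natCast, gaussianBox_natCast, zpow_natCast]
  have e3 : n + 1 + (m + 1) = (n + m + 1) + 1 := by ring
  have e4 : n + (m + 1) = n + m + 1 := by ring
  have e5 : n + 1 + m = n + m + 1 := by ring
  rw [e3, e4, e5, qFactorial_succ (n + m + 1), qFactorial_succ n, qFactorial_succ m]
  have := qFactorial_ne_zero n
  have := qFactorial_ne_zero m
  have := one_sub_X_pow_ne_zero n
  have := one_sub_X_pow_ne_zero m
  field_simp
  ring

/-! ### Restricted pairs: vanishing, symmetry and the unrestricted case. -/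

theorem boxPartitions_of_neg {N M : ℤ} (h : N < 0 ∨ M < 0) : boxPartitions N M = ∅ := by
  rw [boxPartitions, if_neg (by omega)]

theorem mem_boxPartitions {N M : ℤ} (hN : 0 ≤ N) (hM : 0 ≤ M) {p : Fin N.toNat → ℤ} :
    p ∈ boxPartitions N M ↔ (∀ j, 0 ≤ p j ∧ p j ≤ M) ∧ Monotone p := by
  rw [boxPartitions, if_pos ⟨hN, hM⟩]
  simp only [Finset.mem_filter, Fintype.mem_piFinset, Finset.mem_Icc, Monotone]

theorem burgeR_of_neg {N₁ M₁ N₂ M₂ : ℤ} (h : N₁ < 0 ∨ M₁ < 0 ∨ N₂ < 0 ∨ M₂ < 0)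
    (a b α β : ℤ) : burgeR N₁ M₁ N₂ M₂ a b α β = 0 := by
  have : restrictedPairs N₁ M₁ N₂ M₂ a b α β = ∅ := by
    rw [restrictedPairs]
    rcases (by omega : (N₁ < 0 ∨ M₁ < 0) ∨ (N₂ < 0 ∨ M₂ < 0)) with h | h
    · rw [boxPartitions_of_neg h, Finset.empty_product, Finset.filter_empty]
    · rw [boxPartitions_of_neg h, Finset.product_empty, Finset.filter_empty]
  rw [burgeR, this, Finset.sum_empty]

theorem boxPart_mem_Icc {N M : ℤ} (hN : 0 ≤ N) (hM : 0 ≤ M) {p : Fin N.toNat → ℤ}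
    (hp : p ∈ boxPartitions N M) (i : ℤ) : 0 ≤ boxPart N M p i ∧ boxPart N M p i ≤ M := by
  have h := ((mem_boxPartitions hN hM).1 hp).1
  unfold boxPart
  split_ifs with h1 h2
  · exact ⟨le_rfl, hM⟩
  · exact h _
  · exact ⟨hM, le_rfl⟩

theorem isRestricted_swap {N₁ M₁ N₂ M₂ a b α β : ℤ} {r : Fin N₁.toNat → ℤ}
    {p : Fin N₂.toNat → ℤ} (h : IsRestricted N₁ M₁ N₂ M₂ a b α β r p) :
    IsRestricted N₂ M₂ N₁ M₁ b a β α p r := by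
  obtain ⟨h1, h2, h3, h4, h5, h6⟩ := h
  exact ⟨h2, h1, h4, h3, h6, h5⟩

theorem burgeR_swap (N₁ M₁ N₂ M₂ a b α β : ℤ) :
    burgeR N₁ M₁ N₂ M₂ a b α β = burgeR N₂ M₂ N₁ M₁ b a β α := by
  unfold burgeR
  refine Finset.sum_nbij' Prod.swap Prod.swap ?_ ?_ (fun _ _ => rfl) (fun _ _ => rfl) ?_
  · rintro ⟨r, p⟩ h
    simp only [restrictedPairs, Finset.mem_filter, Finset.mem_product, Prod.swap] at h ⊢
    exact ⟨h.1.symm, isRestricted_swap h.2⟩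
  · rintro ⟨r, p⟩ h
    simp only [restrictedPairs, Finset.mem_filter, Finset.mem_product, Prod.swap] at h ⊢
    exact ⟨h.1.symm, isRestricted_swap h.2⟩
  · rintro ⟨r, p⟩ -
    rw [Prod.fst_swap, Prod.snd_swap, add_comm]

/-- There are no restricted pairs if the paths of the two partitions have the same end. -/
theorem burgeR_of_collision {N₁ M₁ N₂ M₂ a α : ℤ} (h : N₁ - N₂ = -a) (h' : M₁ - M₂ = α)
    (b β : ℤ) : burgeR N₁ M₁ N₂ M₂ a b α β = 0 := by
  by_cases hneg : N₁ < 0 ∨ M₁ < 0 ∨ N₂ < 0 ∨ M₂ < 0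
  · exact burgeR_of_neg hneg _ _ _ _
  have : restrictedPairs N₁ M₁ N₂ M₂ a b α β = ∅ := by
    refine Finset.eq_empty_of_forall_notMem fun x hx => ?_
    simp only [restrictedPairs, Finset.mem_filter, Finset.mem_product] at hx
    -- The boundary condition for a = N₂ - N₁ demands a part of size at least M₁ - α + 1 = M₂ + 1.
    have h1 := hx.2.2.2.2.2.1 (by omega)
    have h2 := boxPart_mem_Icc (by omega) (by omega) hx.1.2 N₂
    omega
  rw [burgeR, this, Finset.sum_empty]

/-- The generating function of the partitions in `(N, M)` by weight. -/
noncomputable def boxGenFun (N M : ℤ) : RatFunc ℚ :=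
  ∑ p ∈ boxPartitions N M, (RatFunc.X : RatFunc ℚ) ^ (∑ j, p j)

theorem burgeR_eq_mul {N₁ M₁ N₂ M₂ a b α β : ℤ} (h : M₁ < α ∨ N₂ < a) (h' : M₂ < β ∨ N₁ < b) :
    burgeR N₁ M₁ N₂ M₂ a b α β = boxGenFun N₁ M₁ * boxGenFun N₂ M₂ := by
  by_cases hn : N₁ < 0 ∨ M₁ < 0
  · rw [burgeR_of_neg (by omega), boxGenFun, boxPartitions_of_neg hn, Finset.sum_empty, zero_mul]
  by_cases hn' : N₂ < 0 ∨ M₂ < 0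
  · rw [burgeR_of_neg (by omega), boxGenFun, boxGenFun, boxPartitions_of_neg hn',
      Finset.sum_empty, mul_zero]
  push Not at hn hn'
  have : restrictedPairs N₁ M₁ N₂ M₂ a b α β = boxPartitions N₁ M₁ ×ˢ boxPartitions N₂ M₂ := by
    rw [restrictedPairs, Finset.filter_eq_self]
    rintro ⟨r, p⟩ hx
    rw [Finset.mem_product] at hx
    have hr : ∀ i, _ ∧ boxPart N₁ M₁ r i ≤ _ := boxPart_mem_Icc hn.1 hn.2 hx.1
    have hp : ∀ i, _ ∧ boxPart N₂ M₂ p i ≤ _ := boxPart_mem_Icc hn'.1 hn'.2 hx.2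
    change IsRestricted N₁ M₁ N₂ M₂ a b α β r p
    refine ⟨fun i hi => ?_, fun i hi => ?_, fun _ => ?_, fun _ => ?_, fun _ => ?_, fun _ => ?_⟩
    · rw [Finset.mem_Icc] at hi
      have := hr (i + 1 - a); have := hp i
      omega
    · rw [Finset.mem_Icc] at hi
      have := hp (i + 1 - b); have := hr i
      omega
    · have := hr 1; omega
    · have := hp 1; omega
    · have := hp N₂; omega
    · have := hr N₁; omega
  rw [burgeR, this, Finset.sum_product, boxGenFun, boxGenFun, Finset.sum_mul_sum]
  refine Finset.sum_congr rfl fun r _ => Finset.sum_congr rfl fun p _ => ?_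
  rw [zpow_add₀ RatFunc.X_ne_zero]

/-! ### The recurrence for restricted pairs. -/

/-- The inequalities only involve parts of r with index at most N₁, which do not see the height; the
one condition naming M₁ is vacuous because a ≠ N₂ - N₁. -/
theorem isRestricted_step_height {N₁ M₁ N₂ M₂ a b α β : ℤ} (hN₁ : 0 ≤ N₁) (hN₂ : 0 ≤ N₂)
    (ha : -a < N₁ - N₂) (r : Fin N₁.toNat → ℤ) (p : Fin N₂.toNat → ℤ) :
    IsRestricted N₁ (M₁ - 1) N₂ M₂ a b α β r p ↔ IsRestricted N₁ M₁ N₂ M₂ a b α β r p := by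
  have key : ∀ i ≤ N₁, boxPart N₁ (M₁ - 1) r i = boxPart N₁ M₁ r i := by
    intro i hi
    unfold boxPart
    split_ifs
    · rfl
    · rfl
    · omega
  unfold IsRestricted
  refine and_congr (forall₂_congr fun i hi => ?_) (and_congr (forall₂_congr fun i hi => ?_)
    (and_congr (forall_congr' fun h => ?_) (and_congr Iff.rfl (and_congr ?_ ?_))))
  · rw [Finset.mem_Icc] at hi
    rw [key _ (by omega)]
  · rw [Finset.mem_Icc] at hi
    rw [key _ (by omega)]
  · rw [key _ (by omega)]
  · constructor <;> intro _ _ <;> omega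
  · rw [key _ le_rfl]

/-- The convention p_i = M beyond the last part restores a deleted top part of size M. -/
theorem boxPart_castSucc {n : ℕ} {M : ℤ} (r : Fin (n + 1) → ℤ) (hr : r (Fin.last n) = M) (i : ℤ) :
    boxPart (n : ℤ) M (fun j : Fin n => r j.castSucc) i = boxPart ((n + 1 : ℕ) : ℤ) M r i := by
  unfold boxPart
  simp only [Int.toNat_natCast]
  split_ifs with h1 h2 h3 h3
  · rfl
  · rfl
  · omega
  · have : (⟨(i - 1).toNat, h3⟩ : Fin (n + 1)) = Fin.last n := by
      ext; simp only [Fin.val_last]; omega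
    rw [this, hr]
  · rfl

/-- Deleting the top part loses at most one inequality of each kind. The first, at i = N₂ = n + a,
reappears as the boundary condition of the shorter pair; the second, at i = n + 1, is automatic
since p ≤ M₂ < M₁ + β. -/
theorem isRestricted_step_length {n : ℕ} {M₁ N₂ M₂ a b α β : ℤ} (hN₂ : 0 ≤ N₂) (hM₂ : 0 ≤ M₂)
    (ha₀ : 0 ≤ a) (ha : -a < ((n + 1 : ℕ) : ℤ) - N₂) (hb : ((n + 1 : ℕ) : ℤ) - N₂ ≤ b)
    (hβ : -β < M₁ - M₂) (r : Fin (n + 1) → ℤ) (p : Fin N₂.toNat → ℤ)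
    (hp : p ∈ boxPartitions N₂ M₂) (hr : r (Fin.last n) = M₁) :
    IsRestricted (n : ℤ) M₁ N₂ M₂ a b α β (fun j : Fin n => r j.castSucc) p ↔
      IsRestricted ((n + 1 : ℕ) : ℤ) M₁ N₂ M₂ a b α β r p := by
  have hp' := boxPart_mem_Icc hN₂ hM₂ hp
  have hend : ∀ i : ℤ, (n : ℤ) < i → boxPart ((n + 1 : ℕ) : ℤ) M₁ r i = M₁ := by
    intro i hi
    rw [← boxPart_castSucc r hr]
    unfold boxPart
    rw [if_neg (by omega), dif_neg (by omega)]
  have hp0 : boxPart N₂ M₂ p 0 = 0 := by simp [boxPart]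
  unfold IsRestricted
  simp only [boxPart_castSucc r hr, Finset.mem_Icc]
  constructor
  · rintro ⟨h1, h2, h3, h4, h5, h6⟩
    refine ⟨fun i hi => ?_, fun i hi => ?_, h3, h4, fun _ => by omega, fun _ => ?_⟩
    · by_cases hi' : i ≤ (n : ℤ) + a - 1
      · exact h1 i (by omega)
      · have e : i = N₂ := by omega
        subst e
        have := h5 (by omega)
        rw [hend _ (by omega)]
        omega
    · by_cases hi' : i ≤ n
      · exact h2 i (by omega)
      · rw [hend _ (by omega)]
        have := hp' (i + 1 - b)
        omega
    · rw [hend _ (by omega)]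
      omega
  · rintro ⟨h1, h2, h3, h4, h5, h6⟩
    refine ⟨fun i hi => h1 i (by omega), fun i hi => h2 i (by omega), h3, h4, fun h => ?_,
      fun _ => by omega⟩
    by_cases hN : 1 ≤ N₂
    · have := h1 N₂ (by omega)
      rw [hend _ (by omega)] at this
      omega
    -- With p empty, a = n = 0, and the condition on r_1 = M₁ takes over.
    · have e : N₂ = 0 := by omega
      subst e
      have := h3 (by omega)
      rw [hend _ (by omega)] at this
      rw [hp0]
      omega

theorem filter_restrictedPairs_height {N₁ M₁ N₂ M₂ a b α β : ℤ} (hN₁ : 0 ≤ N₁) (hM₁ : 0 ≤ M₁)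
    (hN₂ : 0 ≤ N₂) (hN : 0 < N₁ + M₁) (ha : -a < N₁ - N₂) :
    (restrictedPairs N₁ M₁ N₂ M₂ a b α β).filter (fun x => ∀ j, x.1 j ≤ M₁ - 1) =
      restrictedPairs N₁ (M₁ - 1) N₂ M₂ a b α β := by
  ext ⟨r, p⟩
  simp only [restrictedPairs, Finset.mem_filter, Finset.mem_product,
    isRestricted_step_height hN₁ hN₂ ha]
  rcases hM₁.eq_or_lt with rfl | hM
  · rw [boxPartitions_of_neg (M := 0 - 1) (by omega)]
    simp only [Finset.notMem_empty, false_and, iff_false, not_and, and_imp]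
    intro hr _ _ h
    have h1 := ((mem_boxPartitions hN₁ le_rfl).1 hr).1 ⟨0, by omega⟩
    have h2 := h ⟨0, by omega⟩
    omega
  · rw [mem_boxPartitions hN₁ hM₁, mem_boxPartitions hN₁ (by omega)]
    constructor
    · rintro ⟨⟨⟨⟨h1, h2⟩, h3⟩, h4⟩, h5⟩
      exact ⟨⟨⟨fun j => ⟨(h1 j).1, h5 j⟩, h2⟩, h3⟩, h4⟩
    · rintro ⟨⟨⟨h1, h2⟩, h3⟩, h4⟩
      exact ⟨⟨⟨⟨fun j => ⟨(h1 j).1, by have := (h1 j).2; omega⟩, h2⟩, h3⟩, h4⟩,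
        fun j => (h1 j).2⟩

theorem sum_filter_restrictedPairs_length {n : ℕ} {M₁ N₂ M₂ a b α β : ℤ} (hM₁ : 0 ≤ M₁)
    (hN₂ : 0 ≤ N₂) (hM₂ : 0 ≤ M₂) (ha₀ : 0 ≤ a) (ha : -a < ((n + 1 : ℕ) : ℤ) - N₂)
    (hb : ((n + 1 : ℕ) : ℤ) - N₂ ≤ b) (hβ : -β < M₁ - M₂) :
    ∑ x ∈ (restrictedPairs ((n + 1 : ℕ) : ℤ) M₁ N₂ M₂ a b α β).filter
        (fun x => ¬ ∀ j, x.1 j ≤ M₁ - 1),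
      (RatFunc.X : RatFunc ℚ) ^ ((∑ j, x.1 j) + ∑ j, x.2 j) =
    RatFunc.X ^ M₁ * burgeR (n : ℤ) M₁ N₂ M₂ a b α β := by
  rw [burgeR, Finset.mul_sum]
  have hlast : ∀ r : Fin (n + 1) → ℤ, r ∈ boxPartitions ((n + 1 : ℕ) : ℤ) M₁ →
      (¬ ∀ j, r j ≤ M₁ - 1) → r (Fin.last n) = M₁ := by
    intro r hr h
    obtain ⟨h1, h2⟩ := (mem_boxPartitions (by omega) hM₁).1 hr
    push Not at h
    obtain ⟨j, hj⟩ := h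
    have h3 := h2 (Fin.le_last j)
    have h4 := (h1 (Fin.last n)).2
    omega
  refine Finset.sum_bij' (fun x _ => ((fun j : Fin n => x.1 (Fin.castSucc j), x.2)))
    (fun x _ => (Fin.snoc (α := fun _ => ℤ) (n := n) x.1 M₁, x.2)) ?_ ?_ ?_ ?_ ?_
  · rintro ⟨r, p⟩ hx
    simp only [restrictedPairs, Finset.mem_filter, Finset.mem_product] at hx ⊢
    obtain ⟨⟨⟨h1, h2⟩, h3⟩, h4⟩ := hx
    have hl := hlast r h1 h4
    refine ⟨⟨?_, h2⟩, (isRestricted_step_length hN₂ hM₂ ha₀ ha hb hβ r p h2 hl).2 h3⟩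
    obtain ⟨h5, h6⟩ := (mem_boxPartitions (by omega) hM₁).1 h1
    exact (mem_boxPartitions (by omega) hM₁).2
      ⟨fun j => h5 _, fun i j hij => h6 (Fin.castSucc_le_castSucc_iff.2 hij)⟩
  · rintro ⟨r, p⟩ hx
    simp only [restrictedPairs, Finset.mem_filter, Finset.mem_product] at hx ⊢
    obtain ⟨⟨h1, h2⟩, h3⟩ := hx
    have hl : Fin.snoc (α := fun _ => ℤ) (n := n) r M₁ (Fin.last n) = M₁ := Fin.snoc_last _ _
    have hc : (fun j : Fin n => Fin.snoc (α := fun _ => ℤ) (n := n) r M₁ (Fin.castSucc j)) = r :=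
      funext fun j => Fin.snoc_castSucc (α := fun _ => ℤ) _ _ _
    have hR := isRestricted_step_length hN₂ hM₂ ha₀ ha hb hβ
      (Fin.snoc (α := fun _ => ℤ) (n := n) r M₁) p h2 hl (α := α)
    rw [hc] at hR
    obtain ⟨h5, h6⟩ := (mem_boxPartitions (by omega) hM₁).1 h1
    refine ⟨⟨⟨(mem_boxPartitions (by omega) hM₁).2 ⟨fun j => ?_, fun i j hij => ?_⟩, h2⟩,
      hR.1 h3⟩, fun h => ?_⟩
    · refine Fin.lastCases ?_ (fun k => ?_) (j : Fin (n + 1))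
      · rw [hl]; exact ⟨hM₁, le_rfl⟩
      · rw [Fin.snoc_castSucc (α := fun _ => ℤ)]; exact h5 k
    · induction (j : Fin (n + 1)) using Fin.lastCases with
      | last =>
        rw [hl]
        induction (i : Fin (n + 1)) using Fin.lastCases with
        | last => rw [hl]
        | cast k => rw [Fin.snoc_castSucc (α := fun _ => ℤ)]; exact (h5 k).2
      | cast l =>
        induction (i : Fin (n + 1)) using Fin.lastCases with
        | last => exact absurd hij (not_le.2 (Fin.castSucc_lt_last l))
        | cast k =>
          rw [Fin.snoc_castSucc (α := fun _ => ℤ), Fin.snoc_castSucc (α := fun _ => ℤ)]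
          exact h6 (Fin.castSucc_le_castSucc_iff.1 hij)
    · have h7 := h (Fin.last n)
      rw [hl] at h7
      omega
  · rintro ⟨r, p⟩ hx
    simp only [restrictedPairs, Finset.mem_filter, Finset.mem_product] at hx
    have hl := hlast r hx.1.1.1 hx.2
    refine Prod.ext (funext fun j => ?_) rfl
    refine Fin.lastCases ?_ (fun k => ?_) (j : Fin (n + 1))
    · exact (Fin.snoc_last (α := fun _ => ℤ) _ _).trans hl.symm
    · exact Fin.snoc_castSucc (α := fun _ => ℤ) _ _ _
  · rintro ⟨r, p⟩ -
    exact Prod.ext (funext fun j => Fin.snoc_castSucc (α := fun _ => ℤ) _ _ _) rfl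
  · rintro ⟨r, p⟩ hx
    simp only [restrictedPairs, Finset.mem_filter, Finset.mem_product] at hx
    have hl := hlast r hx.1.1.1 hx.2
    have hs : ∑ j, r j = ∑ j : Fin n, r (Fin.castSucc j) + M₁ := by
      rw [← hl]; exact Fin.sum_univ_castSucc (n := n) r
    have e : ∑ j, r j + ∑ j, p j = M₁ + (∑ j : Fin n, r (Fin.castSucc j) + ∑ j, p j) := by
      rw [hs]; ring
    rw [← zpow_add₀ RatFunc.X_ne_zero]
    exact congrArg _ e

/-- Removing the last step of the path of the first partition. -/
theorem burgeR_step {N₁ M₁ N₂ M₂ a b α β : ℤ} (hN : N₁ < 0 ∨ M₁ < 0 ∨ 0 < N₁ + M₁)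
    (ha₀ : 0 ≤ a) (ha : -a < N₁ - N₂) (hb : N₁ - N₂ ≤ b) (hβ : -β < M₁ - M₂) :
    burgeR N₁ M₁ N₂ M₂ a b α β =
      RatFunc.X ^ M₁ * burgeR (N₁ - 1) M₁ N₂ M₂ a b α β + burgeR N₁ (M₁ - 1) N₂ M₂ a b α β := by
  -- Out of range all three terms vanish, so the recurrence also applies to inner boxes that have
  -- become negative.
  by_cases hn : N₁ < 0 ∨ M₁ < 0 ∨ N₂ < 0 ∨ M₂ < 0
  · rw [burgeR_of_neg hn, burgeR_of_neg (by omega), burgeR_of_neg (by omega)]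
    ring
  have hM₁ : 0 ≤ M₁ := by omega
  have hN₂ : 0 ≤ N₂ := by omega
  have hM₂ : 0 ≤ M₂ := by omega
  rw [burgeR, ← Finset.sum_filter_add_sum_filter_not _ (fun x => ∀ j, x.1 j ≤ M₁ - 1), add_comm,
    filter_restrictedPairs_height (by omega) hM₁ hN₂ (by omega) ha]
  refine congrArg₂ _ ?_ rfl
  rcases (by omega : N₁ = 0 ∨ 0 < N₁) with rfl | h
  · rw [burgeR_of_neg (by omega), mul_zero]
    refine Finset.sum_eq_zero fun x hx => absurd (fun j => ?_) (Finset.mem_filter.1 hx).2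
    exact Fin.elim0 j
  · obtain ⟨n, rfl⟩ : ∃ n : ℕ, N₁ = (n + 1 : ℕ) := ⟨(N₁ - 1).toNat, by omega⟩
    have e : ((n + 1 : ℕ) : ℤ) - 1 = n := by omega
    rw [e]
    exact sum_filter_restrictedPairs_length hM₁ hN₂ hM₂ ha₀ ha hb hβ

theorem burgeR_step' {N₁ M₁ N₂ M₂ a b α β : ℤ} (hN : N₂ < 0 ∨ M₂ < 0 ∨ 0 < N₂ + M₂)
    (hb₀ : 0 ≤ b) (ha : -a ≤ N₁ - N₂) (hb : N₁ - N₂ < b) (hα : M₁ - M₂ < α) :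
    burgeR N₁ M₁ N₂ M₂ a b α β =
      RatFunc.X ^ M₂ * burgeR N₁ M₁ (N₂ - 1) M₂ a b α β + burgeR N₁ M₁ N₂ (M₂ - 1) a b α β := by
  rw [burgeR_swap, burgeR_step hN hb₀ (by omega) (by omega) (by omega), burgeR_swap (N₂ - 1),
    burgeR_swap N₂]

/-! ### Unrestricted partitions in a box. -/

theorem boxGenFun_of_neg {N M : ℤ} (h : N < 0 ∨ M < 0) : boxGenFun N M = 0 := by
  rw [boxGenFun, boxPartitions_of_neg h, Finset.sum_empty]

theorem boxGenFun_zero_zero : boxGenFun 0 0 = 1 := by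
  have h : ∀ p ∈ boxPartitions 0 0, (RatFunc.X : RatFunc ℚ) ^ (∑ j, p j) = 1 := fun p _ => by
    rw [show ∑ j, p j = 0 from Fin.sum_univ_zero _, zpow_zero]
  have h2 : boxPartitions 0 0 = {fun _ => 0} := by
    ext p
    rw [mem_boxPartitions le_rfl le_rfl, Finset.mem_singleton]
    exact ⟨fun _ => funext fun j => Fin.elim0 j,
      fun _ => ⟨fun j => Fin.elim0 j, fun j => Fin.elim0 j⟩⟩
  rw [boxGenFun, Finset.sum_congr rfl h, h2, Finset.sum_singleton]

theorem boxGenFun_step {N M : ℤ} (hN : 0 ≤ N) (hM : 0 ≤ M) (h : 0 < N + M) :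
    boxGenFun N M = RatFunc.X ^ M * boxGenFun (N - 1) M + boxGenFun N (M - 1) := by
  -- With the second box empty and these parameters every restriction is vacuous, so `burgeR_step`
  -- yields the recurrence for one box.
  have key : ∀ N' M' : ℤ, N' ≤ N → M' ≤ M →
      burgeR N' M' 0 0 1 (N + 1) (M + 1) 1 = boxGenFun N' M' := fun N' M' h1 h2 => by
    rw [burgeR_eq_mul (by omega) (by omega), boxGenFun_zero_zero, mul_one]
  rw [← key N M le_rfl le_rfl, ← key (N - 1) M (by omega) le_rfl,
    ← key N (M - 1) le_rfl (by omega)]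
  exact burgeR_step (by omega) (by omega) (by omega) (by omega) (by omega)

theorem boxGenFun_eq_gaussianBox (N M : ℤ) : boxGenFun N M = gaussianBox N M := by
  induction hk : (N + M).toNat generalizing N M with
  | zero =>
    by_cases hn : N < 0 ∨ M < 0
    · rw [boxGenFun_of_neg hn, gaussianBox_of_neg hn]
    · obtain rfl : N = 0 := by omega
      obtain rfl : M = 0 := by omega
      rw [boxGenFun_zero_zero, gaussianBox_zero_left le_rfl]
  | succ k ih =>
    by_cases hn : N < 0 ∨ M < 0
    · rw [boxGenFun_of_neg hn, gaussianBox_of_neg hn]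
    · rw [boxGenFun_step (by omega) (by omega) (by omega),
        gaussianBox_step (by omega) (by omega) (by omega), ih _ _ (by omega), ih _ _ (by omega)]

/-- If the boxes are too small for a restriction, all partition pairs are restricted. -/
theorem burgeR_eq_gaussianBox_mul {N₁ M₁ N₂ M₂ a b α β : ℤ} (h : M₁ < α ∨ N₂ < a)
    (h' : M₂ < β ∨ N₁ < b) :
    burgeR N₁ M₁ N₂ M₂ a b α β = gaussianBox N₁ M₁ * gaussianBox N₂ M₂ := by
  rw [burgeR_eq_mul h h', boxGenFun_eq_gaussianBox, boxGenFun_eq_gaussianBox]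

/-! ### The right-hand side: symmetry and recurrence. -/

theorem sum_Icc_sub_pred (f : ℤ → RatFunc ℚ) (n : ℕ) :
    ∑ i ∈ Finset.Icc 0 (n : ℤ), (f i - f (i - 1)) = f n - f (-1) := by
  induction n with
  | zero => simp
  | succ n ih =>
    have : Finset.Icc 0 ((n + 1 : ℕ) : ℤ) = insert ((n + 1 : ℕ) : ℤ) (Finset.Icc 0 (n : ℤ)) := by
      ext i
      simp only [Finset.mem_insert, Finset.mem_Icc]
      omega
    rw [this, Finset.sum_insert (by simp), ih]
    have e : ((n + 1 : ℕ) : ℤ) - 1 = n := by omega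
    rw [e]
    ring

/-- The summands of the Burge summation formula. -/
noncomputable def burgeTerm (N₁ M₁ N₂ M₂ a b α β i : ℤ) : RatFunc ℚ :=
  RatFunc.X ^ (i ^ 2 + i * (N₁ - N₂)) * gaussianBox (N₂ - i) (M₁ + M₂) *
    burgeR (i + (N₁ - N₂)) (M₁ - i) i (M₂ - (N₁ - N₂) - i) a b (α - a) (β - b)

/-- The right-hand side of the Burge summation formula. -/
noncomputable def burgeSum (N₁ M₁ N₂ M₂ a b α β : ℤ) : RatFunc ℚ :=
  ∑ i ∈ Finset.Icc 0 N₂, burgeTerm N₁ M₁ N₂ M₂ a b α β i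

theorem burgeTerm_swap (N₁ M₁ N₂ M₂ a b α β i : ℤ) :
    burgeTerm N₂ M₂ N₁ M₁ b a β α (i + (N₁ - N₂)) = burgeTerm N₁ M₁ N₂ M₂ a b α β i := by
  rw [burgeTerm, burgeTerm, burgeR_swap]
  congr 1
  · congr 2
    · ring
    · ring
    · ring
  · congr 1 <;> ring

theorem burgeTerm_of_neg {N₁ N₂ i : ℤ} (h : i < 0 ∨ i + (N₁ - N₂) < 0) (M₁ M₂ a b α β : ℤ) :
    burgeTerm N₁ M₁ N₂ M₂ a b α β i = 0 := by
  rw [burgeTerm, burgeR_of_neg (by omega), mul_zero]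

/-- The shift i ↦ i + N₁ - N₂ matches the nonzero terms, although the two index ranges differ. -/
theorem burgeSum_swap (N₁ M₁ N₂ M₂ a b α β : ℤ) :
    burgeSum N₂ M₂ N₁ M₁ b a β α = burgeSum N₁ M₁ N₂ M₂ a b α β := by
  symm
  refine Finset.sum_bij_ne_zero (fun i _ _ => i + (N₁ - N₂)) ?_ ?_ ?_ ?_
  · intro i hi h
    have : ¬ (i < 0 ∨ i + (N₁ - N₂) < 0) := fun h' => h (burgeTerm_of_neg h' _ _ _ _ _ _)
    rw [Finset.mem_Icc] at hi ⊢
    omega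
  · intro i _ _ j _ _ h
    omega
  · intro i hi h
    have : ¬ (i < 0 ∨ i + (N₂ - N₁) < 0) := fun h' => h (burgeTerm_of_neg h' _ _ _ _ _ _)
    rw [Finset.mem_Icc] at hi
    refine ⟨i + (N₂ - N₁), ?_, ?_, by ring⟩
    · rw [Finset.mem_Icc]; omega
    · rwa [burgeTerm_swap]
  · intro i _ _
    rw [burgeTerm_swap]

theorem burgeSum_of_neg {N₁ M₁ N₂ M₂ : ℤ} (h : N₁ < 0 ∨ M₁ < 0 ∨ N₂ < 0 ∨ M₂ < 0)
    (a b α β : ℤ) : burgeSum N₁ M₁ N₂ M₂ a b α β = 0 := by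
  refine Finset.sum_eq_zero fun i hi => ?_
  rw [Finset.mem_Icc] at hi
  rw [burgeTerm, burgeR_of_neg (by omega), mul_zero]

/-- The i-th terms differ by c i - c (i - 1). Expanding the inner R's leaves Z i, Z (i - 1) and a
common U, whose coefficients cancel by q-Pascal. The strict bounds `hβ` and `hM₁` are what the inner
`burgeR_step` needs. -/
theorem burgeSum_step {N₁ M₁ N₂ M₂ a b α β : ℤ} (hN₂ : 0 ≤ N₂) (ha₀ : 0 ≤ a) (hb₀ : 0 ≤ b)
    (ha : -a < N₁ - N₂) (hb : N₁ - N₂ ≤ b) (hβ : b - β < M₁ - M₂ + (N₁ - N₂))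
    (hα : M₁ - M₂ + (N₁ - N₂) ≤ α - a) (hM₁ : 0 < M₁ + (N₁ - N₂)) (hM₂ : 0 ≤ M₂ - (N₁ - N₂)) :
    burgeSum N₁ M₁ N₂ M₂ a b α β =
      RatFunc.X ^ M₁ * burgeSum (N₁ - 1) M₁ N₂ M₂ a b α β +
        burgeSum N₁ (M₁ - 1) N₂ M₂ a b α β := by
  have hX : (RatFunc.X : RatFunc ℚ) ≠ 0 := RatFunc.X_ne_zero
  let Z : ℤ → RatFunc ℚ := fun i =>
    burgeR (i + (N₁ - N₂)) (M₁ - 1 - i) i (M₂ - (N₁ - N₂) - i) a b (α - a) (β - b)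
  let c : ℤ → RatFunc ℚ := fun i =>
    RatFunc.X ^ (i ^ 2 + i * (N₁ - N₂) + M₁ + M₂) * gaussianBox (N₂ - i - 1) (M₁ + M₂) * Z i
  have key : ∀ i ∈ Finset.Icc 0 N₂, burgeTerm N₁ M₁ N₂ M₂ a b α β i -
      (RatFunc.X ^ M₁ * burgeTerm (N₁ - 1) M₁ N₂ M₂ a b α β i +
        burgeTerm N₁ (M₁ - 1) N₂ M₂ a b α β i) = c i - c (i - 1) := by
    intro i hi
    rw [Finset.mem_Icc] at hi
    let U := burgeR (i + (N₁ - N₂) - 1) (M₁ - i) i (M₂ - (N₁ - N₂) - i) a b (α - a) (β - b)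
    have h1 : burgeR (i + (N₁ - N₂)) (M₁ - i) i (M₂ - (N₁ - N₂) - i) a b (α - a) (β - b) =
        RatFunc.X ^ (M₁ - i) * U + Z i := by
      rw [burgeR_step (by omega) ha₀ (by omega) (by omega) (by omega)]
      simp only [U, Z]
      congr 2
      ring
    have h2 : burgeR (i + (N₁ - 1 - N₂)) (M₁ - i) i (M₂ - (N₁ - 1 - N₂) - i) a b (α - a) (β - b) =
        RatFunc.X ^ (M₂ - (N₁ - N₂) + 1 - i) * Z (i - 1) + U := by
      rw [burgeR_step' (by omega) hb₀ (by omega) (by omega) (by omega)]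
      simp only [U, Z]
      congr 1
      · congr 1
        · congr 1; ring
        · congr 1 <;> ring
      · congr 1 <;> ring
    have h3 := gaussianBox_step (N := N₂ - i) (M := M₁ + M₂) (by omega) (by omega) (by omega)
    have h4 : N₂ - (i - 1) - 1 = N₂ - i := by ring
    have h5 : M₁ - 1 + M₂ = M₁ + M₂ - 1 := by ring
    simp only [burgeTerm, c]
    rw [h1, h2, h4, h5]
    change _ - (_ + _ * _ * Z i) = _
    rw [h3]
    set g := gaussianBox (N₂ - i - 1) (M₁ + M₂)
    set g' := gaussianBox (N₂ - i) (M₁ + M₂ - 1)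
    have e1 : (RatFunc.X : RatFunc ℚ) ^ ((i - 1) ^ 2 + (i - 1) * (N₁ - N₂) + M₁ + M₂) =
        RatFunc.X ^ M₁ * RatFunc.X ^ (i ^ 2 + i * (N₁ - 1 - N₂)) *
          RatFunc.X ^ (M₂ - (N₁ - N₂) + 1 - i) := by
      rw [← zpow_add₀ hX, ← zpow_add₀ hX]; congr 1; ring
    have e2 : (RatFunc.X : RatFunc ℚ) ^ (i ^ 2 + i * (N₁ - N₂)) * RatFunc.X ^ (M₁ - i) =
        RatFunc.X ^ M₁ * RatFunc.X ^ (i ^ 2 + i * (N₁ - 1 - N₂)) := by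
      rw [← zpow_add₀ hX, ← zpow_add₀ hX]; congr 1; ring
    have e3 : (RatFunc.X : RatFunc ℚ) ^ (i ^ 2 + i * (N₁ - N₂) + M₁ + M₂) =
        RatFunc.X ^ (i ^ 2 + i * (N₁ - N₂)) * RatFunc.X ^ (M₁ + M₂) := by
      rw [← zpow_add₀ hX]; congr 1; ring
    rw [e1, e3]
    linear_combination (RatFunc.X ^ (M₁ + M₂) * g + g') * U * e2
  rw [← sub_eq_zero]
  simp only [burgeSum]
  rw [Finset.mul_sum, ← Finset.sum_add_distrib, ← Finset.sum_sub_distrib,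
    Finset.sum_congr rfl key]
  lift N₂ to ℕ using hN₂
  rw [sum_Icc_sub_pred]
  simp only [c, Z]
  -- Both ends of the telescope vanish: c N₂ through its Gaussian polynomial, c (-1) through its R.
  rw [gaussianBox_of_neg (by omega), burgeR_of_neg (N₂ := -1) (by omega)]
  ring

theorem burgeSum_step' {N₁ M₁ N₂ M₂ a b α β : ℤ} (hN₁ : 0 ≤ N₁) (ha₀ : 0 ≤ a) (hb₀ : 0 ≤ b)
    (ha : -a ≤ N₁ - N₂) (hb : N₁ - N₂ < b) (hβ : b - β ≤ M₁ - M₂ + (N₁ - N₂))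
    (hα : M₁ - M₂ + (N₁ - N₂) < α - a) (hM₁ : 0 ≤ M₁ + (N₁ - N₂)) (hM₂ : 0 < M₂ - (N₁ - N₂)) :
    burgeSum N₁ M₁ N₂ M₂ a b α β =
      RatFunc.X ^ M₂ * burgeSum N₁ M₁ (N₂ - 1) M₂ a b α β +
        burgeSum N₁ M₁ N₂ (M₂ - 1) a b α β := by
  rw [← burgeSum_swap, burgeSum_step hN₁ hb₀ ha₀ (by omega) (by omega) (by omega) (by omega)
    (by omega) (by omega), burgeSum_swap N₁ M₁ (N₂ - 1), burgeSum_swap N₁ M₁ N₂]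

/-! ### Extreme cases and the induction. -/

theorem burgeSum_of_collision {N₁ M₁ N₂ M₂ a α : ℤ} (h : N₁ - N₂ = -a) (h' : M₁ - M₂ = α)
    (b β : ℤ) : burgeSum N₁ M₁ N₂ M₂ a b α β = 0 := by
  refine Finset.sum_eq_zero fun i _ => ?_
  rw [burgeTerm, burgeR_of_collision (by omega) (by omega), mul_zero]

/-- If only the term `i = 0` can contribute and one box is flat, both sides are the same Gaussian
polynomial. -/
theorem burgeR_eq_burgeSum_of_eq {N₁ M₁ N₂ M₂ a b α β : ℤ} (hN₁ : 0 ≤ N₁) (hM₁ : 0 ≤ M₁)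
    (hN₂ : 0 ≤ N₂) (hM₂ : 0 ≤ M₂) (h : M₂ = N₁ - N₂) (h0 : M₁ = 0 ∨ M₂ = 0)
    (hα : M₁ < α) (hβ : M₂ < β) (hα' : M₁ < α - a ∨ 0 < a) (hβ' : 0 < β - b ∨ M₂ < b) :
    burgeR N₁ M₁ N₂ M₂ a b α β = burgeSum N₁ M₁ N₂ M₂ a b α β := by
  rw [burgeR_eq_gaussianBox_mul (.inl hα) (.inl hβ), burgeSum,
    Finset.sum_eq_single_of_mem 0 (Finset.mem_Icc.2 ⟨le_rfl, hN₂⟩)]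
  · have e : M₂ - (N₁ - N₂) - 0 = 0 := by omega
    have e' : 0 + (N₁ - N₂) = M₂ := by omega
    -- At i = 0 the second inner box is 0 × 0, so the inner R is a single Gaussian polynomial.
    rw [burgeTerm, e, e', burgeR_eq_gaussianBox_mul (by omega) (by omega),
      gaussianBox_zero_left le_rfl]
    simp only [sub_zero, mul_one, ne_eq, OfNat.ofNat_ne_zero, not_false_eq_true, zero_pow,
      zero_mul, add_zero, zpow_zero, one_mul]
    rcases h0 with rfl | rfl
    · rw [gaussianBox_zero_right hN₁, gaussianBox_zero_right hM₂, zero_add]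
      ring
    · obtain rfl : N₁ = N₂ := by omega
      rw [gaussianBox_zero_right hN₁, gaussianBox_zero_left hM₁, add_zero]
  · intro i hi h
    rw [Finset.mem_Icc] at hi
    rw [burgeTerm, burgeR_of_neg (by omega), mul_zero]

theorem burgeR_eq_burgeSum {N₁ M₁ N₂ M₂ a b α β : ℤ} (ha : 0 ≤ a) (hb : 0 ≤ b) (hab : 0 < a + b)
    (hα : 0 ≤ α - a) (hβ : 0 ≤ β - b) (hαβ : 0 < (α - a) + (β - b))
    (h₁ : -a ≤ N₁ - N₂) (h₂ : N₁ - N₂ ≤ b) (h₅ : b - β ≤ M₁ - M₂ + (N₁ - N₂))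
    (h₆ : M₁ - M₂ + (N₁ - N₂) ≤ α - a) (h₇ : 0 ≤ M₁ + (N₁ - N₂)) (h₈ : 0 ≤ M₂ - (N₁ - N₂)) :
    burgeR N₁ M₁ N₂ M₂ a b α β = burgeSum N₁ M₁ N₂ M₂ a b α β := by
  induction hk : (N₁ + M₁ + N₂ + M₂).toNat using Nat.strong_induction_on
    generalizing N₁ M₁ N₂ M₂ with
  | _ k ih =>
  by_cases hn : N₁ < 0 ∨ M₁ < 0 ∨ N₂ < 0 ∨ M₂ < 0
  · rw [burgeR_of_neg hn, burgeSum_of_neg hn]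
  by_cases hc : N₁ - N₂ = -a ∧ M₁ - M₂ = α
  · rw [burgeR_of_collision hc.1 hc.2, burgeSum_of_collision hc.1 hc.2]
  by_cases hc' : N₂ - N₁ = -b ∧ M₂ - M₁ = β
  · rw [burgeR_swap, ← burgeSum_swap, burgeR_of_collision hc'.1 hc'.2,
      burgeSum_of_collision hc'.1 hc'.2]
  push Not at hn
  -- These are the bounds that shrink when N₁ or M₁ drops by one; strictness keeps them valid for
  -- the induction hypothesis.
  by_cases hr : -a < N₁ - N₂ ∧ b - β < M₁ - M₂ + (N₁ - N₂) ∧ 0 < M₁ + (N₁ - N₂)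
  · rw [burgeR_step (by omega) ha (by omega) (by omega) (by omega),
      burgeSum_step hn.2.2.1 ha hb hr.1 h₂ hr.2.1 h₆ hr.2.2 h₈,
      ih _ (by omega) (by omega) (by omega) (by omega) (by omega) (by omega) (by omega) rfl,
      ih _ (by omega) (by omega) (by omega) (by omega) (by omega) (by omega) (by omega) rfl]
  by_cases hp : N₁ - N₂ < b ∧ M₁ - M₂ + (N₁ - N₂) < α - a ∧ 0 < M₂ - (N₁ - N₂)
  · rw [burgeR_step' (by omega) hb (by omega) (by omega) (by omega),
      burgeSum_step' hn.1 ha hb h₁ hp.1 h₅ hp.2.1 h₇ hp.2.2,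
      ih _ (by omega) (by omega) (by omega) (by omega) (by omega) (by omega) (by omega) rfl,
      ih _ (by omega) (by omega) (by omega) (by omega) (by omega) (by omega) (by omega) rfl]
  -- With both recurrences blocked and collisions excluded, M₂ = N₁ - N₂ or M₁ = N₂ - N₁, and one of
  -- M₁, M₂ is 0.
  by_cases h : M₂ = N₁ - N₂
  · exact burgeR_eq_burgeSum_of_eq hn.1 hn.2.1 hn.2.2.1 hn.2.2.2 h (by omega) (by omega)
      (by omega) (by omega) (by omega)
  · rw [burgeR_swap, ← burgeSum_swap]
    exact burgeR_eq_burgeSum_of_eq hn.2.2.1 hn.2.2.2 hn.1 hn.2.1 (by omega) (by omega) (by omega)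
      (by omega) (by omega) (by omega)

theorem mainTheorem8 (N₁ M₁ N₂ M₂ a b α β ΔN ΔM : ℤ)
    (hN₁ : 0 ≤ N₁) (hM₁ : 0 ≤ M₁) (hN₂ : 0 ≤ N₂) (hM₂ : 0 ≤ M₂)
    (ha : 0 ≤ a) (hb : 0 ≤ b) (hab : 0 < a + b)
    (hα : 0 ≤ α - a) (hβ : 0 ≤ β - b) (hαβ : 0 < (α - a) + (β - b))
    (hΔN : ΔN = N₁ - N₂) (hΔM : ΔM = M₁ - M₂)
    (h₁ : -a ≤ ΔN) (h₂ : ΔN ≤ b) (h₃ : -β ≤ ΔM) (h₄ : ΔM ≤ α)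
    (h₅ : b - β ≤ ΔM + ΔN) (h₆ : ΔM + ΔN ≤ α - a)
    (h₇ : 0 ≤ M₁ + ΔN) (h₈ : 0 ≤ M₂ - ΔN) :
    burgeR N₁ M₁ N₂ M₂ a b α β =
      ∑ i ∈ Finset.Icc 0 N₂,
        (RatFunc.X : RatFunc ℚ) ^ (i ^ 2 + i * ΔN) *
          gaussianPoly (M₁ + M₂ + N₂ - i) (N₂ - i) *
          burgeR (i + ΔN) (M₁ - i) i (M₂ - ΔN - i) a b (α - a) (β - b) := by
  subst hΔN hΔM
  rw [burgeR_eq_burgeSum ha hb hab hα hβ hαβ h₁ h₂ h₅ h₆ h₇ h₈, burgeSum]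
  refine Finset.sum_congr rfl fun i _ => ?_
  rw [burgeTerm, gaussianBox]
  congr 3
  ring
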